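/- **Setting.** Let $\mathcal P$ be a nonempty set and $\Lambda,\Sigma_1,\Sigma_2$ nonempty sets of subsets of $\mathcal P$ with $\Sigma_1\cap\Sigma_2=\emptyset$; elements of $\Lambda$ are called circles, elements of $\Sigma_1\cup\Sigma_2$ generators. $(\mathcal P,\Lambda,\Sigma_1\cup\Sigma_2)$ is a hyperbola structure if: (H1) for each point $p$ and each $i\in\{1,2\}$ exactly one generator of $\Sigma_i$, denoted $[p]_i$, contains $p$; (H2) any $A\in\Sigma_1$ and $B\in\Sigma_2$ meet in exactly one point; (H3) every generator meets every circle in exactly one point; (H4) any three points $a,b,c$ such that $[a]_i,[b]_i,[c]_i$ are pairwise different for $i=1$ and for $i=2$ lie on exactly one common circle; (H5) some circle contains at least three points. For points $p,q$ and a circle $K$ write $pq$ for the common point of $[p]_1$ and $[q]_2$, $pK$ for the common point of $[p]_1$ and $K$, and $Kp$ for the common point of $[p]_2$ and $K$. The point $S_K(p)$ symmetric to $p$ with respect to $K$ is the unique point $p'$ such that $pp'\in K$ and $p'p\in K$. Circles $K\ne L$ are orthogonal, $K\perp L$, if $S_K(p)\in L$ for every $p\in L$. A symmetric Minkowski plane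 is a hyperbola structure with the property: (S) for any circles $K,L$ and any point $p\in L\setminus K$, if $S_K(p)\in L$, then $K\perp L$. **Corollary 4.4.** Let $K,L,M,N$ be circles of a symmetric Minkowski plane such that (i') there is a point $x\in M$ with $xN\neq xL$ and $K(xN)=(Lx)K$; (ii) $K\perp L$, $K\perp N$, $M\perp L$ and $M\perp N$. Then for all points $k\in K$, $l\in L$, $m\in M$, $n\in N$ with $k\in[l]_1$, $l\in[m]_2$ and $m\in[n]_1$ we have $k\in[n]_2$. -/

import Mathlib

universe u

/-- A point set with a family of circles and two families of generators. -/
structure CircleGeometry (P : Type u) where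
  circles : Set (Set P)
  gen₁ : Set (Set P)
  gen₂ : Set (Set P)

namespace CircleGeometry

variable {P : Type u}

/-- `[p]₁`: the union of the generators of the first family through `p`.  In a hyperbola structure
there is exactly one such generator, and `[p]₁` is that generator
(see `HyperbolaStructure.cls₁_eq`). -/
def cls₁ (𝓖 : CircleGeometry P) (p : P) : Set P := {x | ∃ G ∈ 𝓖.gen₁, p ∈ G ∧ x ∈ G}

/-- `[p]₂`: the generator of the second family through `p`. -/
def cls₂ (𝓖 : CircleGeometry P) (p : P) : Set P := {x | ∃ G ∈ 𝓖.gen₂, p ∈ G ∧ x ∈ G}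

end CircleGeometry

/-- Hyperbola structures. -/
structure HyperbolaStructure (P : Type u) extends CircleGeometry P where
  points_nonempty : Nonempty P
  circles_nonempty : circles.Nonempty
  gen₁_nonempty : gen₁.Nonempty
  gen₂_nonempty : gen₂.Nonempty
  gen_disjoint : gen₁ ∩ gen₂ = ∅
  /-- every point lies on exactly one generator of each family -/
  exists_unique_gen₁ : ∀ p : P, ∃! G : Set P, G ∈ gen₁ ∧ p ∈ G
  exists_unique_gen₂ : ∀ p : P, ∃! G : Set P, G ∈ gen₂ ∧ p ∈ G
  /-- generators of different families meet in exactly one point -/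
  gen_inter_gen : ∀ A ∈ gen₁, ∀ B ∈ gen₂, ∃! x : P, x ∈ A ∩ B
  /-- every generator meets every circle in exactly one point -/
  gen_inter_circle : ∀ A ∈ gen₁ ∪ gen₂, ∀ C ∈ circles, ∃! x : P, x ∈ A ∩ C
  /-- three points, no two of them on a common generator, lie on exactly one circle -/
  exists_unique_circle : ∀ a b c : P,
    toCircleGeometry.cls₁ a ≠ toCircleGeometry.cls₁ b →
    toCircleGeometry.cls₁ b ≠ toCircleGeometry.cls₁ c →
    toCircleGeometry.cls₁ c ≠ toCircleGeometry.cls₁ a →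
    toCircleGeometry.cls₂ a ≠ toCircleGeometry.cls₂ b →
    toCircleGeometry.cls₂ b ≠ toCircleGeometry.cls₂ c →
    toCircleGeometry.cls₂ c ≠ toCircleGeometry.cls₂ a →
    ∃! C : Set P, C ∈ circles ∧ a ∈ C ∧ b ∈ C ∧ c ∈ C
  /-- some circle contains at least three points -/
  exists_three_points : ∃ C ∈ circles, ∃ a ∈ C, ∃ b ∈ C, ∃ c ∈ C, a ≠ b ∧ b ≠ c ∧ c ≠ a

namespace HyperbolaStructure

variable {P : Type u} (𝓜 : HyperbolaStructure P)

/-- The type of circles. -/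
abbrev Circle : Type u := {C : Set P // C ∈ 𝓜.circles}

theorem cls₁_eq {p : P} {G : Set P} (hG : G ∈ 𝓜.gen₁) (hp : p ∈ G) : 𝓜.cls₁ p = G := by
  ext x
  constructor
  · rintro ⟨G', hG', hp', hx⟩
    rwa [(𝓜.exists_unique_gen₁ p).unique ⟨hG, hp⟩ ⟨hG', hp'⟩]
  · intro hx
    exact ⟨G, hG, hp, hx⟩

theorem cls₂_eq {p : P} {G : Set P} (hG : G ∈ 𝓜.gen₂) (hp : p ∈ G) : 𝓜.cls₂ p = G := by
  ext x
  constructor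
  · rintro ⟨G', hG', hp', hx⟩
    rwa [(𝓜.exists_unique_gen₂ p).unique ⟨hG, hp⟩ ⟨hG', hp'⟩]
  · intro hx
    exact ⟨G, hG, hp, hx⟩

theorem cls₁_mem_gen₁ (p : P) : 𝓜.cls₁ p ∈ 𝓜.gen₁ := by
  obtain ⟨G, ⟨hG, hp⟩, -⟩ := 𝓜.exists_unique_gen₁ p
  rwa [𝓜.cls₁_eq hG hp]

theorem cls₂_mem_gen₂ (p : P) : 𝓜.cls₂ p ∈ 𝓜.gen₂ := by
  obtain ⟨G, ⟨hG, hp⟩, -⟩ := 𝓜.exists_unique_gen₂ p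
  rwa [𝓜.cls₂_eq hG hp]

theorem exists_unique_meet (p q : P) : ∃! x : P, x ∈ 𝓜.cls₁ p ∩ 𝓜.cls₂ q :=
  𝓜.gen_inter_gen _ (𝓜.cls₁_mem_gen₁ p) _ (𝓜.cls₂_mem_gen₂ q)

theorem exists_unique_proj₁ (p : P) (K : 𝓜.Circle) : ∃! x : P, x ∈ 𝓜.cls₁ p ∩ K.1 :=
  𝓜.gen_inter_circle _ (Or.inl (𝓜.cls₁_mem_gen₁ p)) _ K.2

theorem exists_unique_proj₂ (K : 𝓜.Circle) (p : P) : ∃! x : P, x ∈ 𝓜.cls₂ p ∩ K.1 :=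
  𝓜.gen_inter_circle _ (Or.inr (𝓜.cls₂_mem_gen₂ p)) _ K.2

/-- The point `pq`, i.e. the common point of `[p]₁` and `[q]₂`. -/
noncomputable def meet (p q : P) : P := (𝓜.exists_unique_meet p q).choose

/-- The point `pK`, i.e. the common point of `[p]₁` and the circle `K`. -/
noncomputable def proj₁ (p : P) (K : 𝓜.Circle) : P := (𝓜.exists_unique_proj₁ p K).choose

/-- The point `Kp`, i.e. the common point of `[p]₂` and the circle `K`. -/
noncomputable def proj₂ (K : 𝓜.Circle) (p : P) : P := (𝓜.exists_unique_proj₂ K p).choose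

/-- Two points `p`, `q` are symmetric with respect to the circle `K` if `pq` and `qp` lie
on `K`. -/
def IsSymmetric (K : 𝓜.Circle) (p q : P) : Prop := 𝓜.meet p q ∈ K.1 ∧ 𝓜.meet q p ∈ K.1

theorem meet_mem (p q : P) : 𝓜.meet p q ∈ 𝓜.cls₁ p ∩ 𝓜.cls₂ q :=
  (𝓜.exists_unique_meet p q).choose_spec.1

theorem proj₁_mem (p : P) (K : 𝓜.Circle) : 𝓜.proj₁ p K ∈ 𝓜.cls₁ p ∩ K.1 :=
  (𝓜.exists_unique_proj₁ p K).choose_spec.1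

theorem proj₂_mem (K : 𝓜.Circle) (p : P) : 𝓜.proj₂ K p ∈ 𝓜.cls₂ p ∩ K.1 :=
  (𝓜.exists_unique_proj₂ K p).choose_spec.1

theorem self_mem_cls₁ (p : P) : p ∈ 𝓜.cls₁ p := by
  obtain ⟨G, ⟨hG, hp⟩, -⟩ := 𝓜.exists_unique_gen₁ p
  exact ⟨G, hG, hp, hp⟩

theorem self_mem_cls₂ (p : P) : p ∈ 𝓜.cls₂ p := by
  obtain ⟨G, ⟨hG, hp⟩, -⟩ := 𝓜.exists_unique_gen₂ p
  exact ⟨G, hG, hp, hp⟩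

theorem cls₁_eq_of_mem {p q : P} (h : q ∈ 𝓜.cls₁ p) : 𝓜.cls₁ q = 𝓜.cls₁ p :=
  𝓜.cls₁_eq (𝓜.cls₁_mem_gen₁ p) h

theorem cls₂_eq_of_mem {p q : P} (h : q ∈ 𝓜.cls₂ p) : 𝓜.cls₂ q = 𝓜.cls₂ p :=
  𝓜.cls₂_eq (𝓜.cls₂_mem_gen₂ p) h

/-- For each `p` there is exactly one point symmetric to `p` with respect to `K`. -/
theorem exists_unique_isSymmetric (K : 𝓜.Circle) (p : P) : ∃! q : P, 𝓜.IsSymmetric K p q := by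
  have e1 : 𝓜.cls₁ (𝓜.proj₂ K p) = 𝓜.cls₁ (𝓜.meet (𝓜.proj₂ K p) (𝓜.proj₁ p K)) :=
    (𝓜.cls₁_eq_of_mem (𝓜.meet_mem _ _).1).symm
  have e2 : 𝓜.cls₂ (𝓜.proj₁ p K) = 𝓜.cls₂ (𝓜.meet (𝓜.proj₂ K p) (𝓜.proj₁ p K)) :=
    (𝓜.cls₂_eq_of_mem (𝓜.meet_mem _ _).2).symm
  refine ⟨𝓜.meet (𝓜.proj₂ K p) (𝓜.proj₁ p K), ⟨?_, ?_⟩, ?_⟩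
  · have h := (𝓜.exists_unique_meet p (𝓜.meet (𝓜.proj₂ K p) (𝓜.proj₁ p K))).unique
      (𝓜.meet_mem _ _) ⟨(𝓜.proj₁_mem p K).1, e2 ▸ 𝓜.self_mem_cls₂ _⟩
    rw [h]
    exact (𝓜.proj₁_mem p K).2
  · have h := (𝓜.exists_unique_meet (𝓜.meet (𝓜.proj₂ K p) (𝓜.proj₁ p K)) p).unique
      (𝓜.meet_mem _ _) ⟨e1 ▸ 𝓜.self_mem_cls₁ _, (𝓜.proj₂_mem K p).1⟩
    rw [h]
    exact (𝓜.proj₂_mem K p).2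
  · rintro q ⟨h1, h2⟩
    have a1 : 𝓜.meet p q = 𝓜.proj₁ p K :=
      (𝓜.exists_unique_proj₁ p K).unique ⟨(𝓜.meet_mem p q).1, h1⟩ (𝓜.proj₁_mem p K)
    have a2 : 𝓜.meet q p = 𝓜.proj₂ K p :=
      (𝓜.exists_unique_proj₂ K p).unique ⟨(𝓜.meet_mem q p).2, h2⟩ (𝓜.proj₂_mem K p)
    refine (𝓜.exists_unique_meet _ _).unique ⟨?_, ?_⟩ (𝓜.meet_mem _ _)
    · rw [← a2, 𝓜.cls₁_eq_of_mem (𝓜.meet_mem q p).1]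
      exact 𝓜.self_mem_cls₁ q
    · rw [← a1, 𝓜.cls₂_eq_of_mem (𝓜.meet_mem p q).2]
      exact 𝓜.self_mem_cls₂ q

/-- The circle symmetry `S_K`: it sends `p` to the unique point symmetric to `p` with respect
to `K`. -/
noncomputable def symm (K : 𝓜.Circle) (p : P) : P := (𝓜.exists_unique_isSymmetric K p).choose

/-- Orthogonality of two different circles: `S_K` maps every point of `L` to a point of `L`. -/
def Orthogonal (K L : 𝓜.Circle) : Prop := K ≠ L ∧ ∀ p ∈ L.1, 𝓜.symm K p ∈ L.1

/-- The symmetry axiom. -/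
def SymmetryAxiom : Prop :=
  ∀ K L : 𝓜.Circle, ∀ p ∈ L.1 \ K.1, 𝓜.symm K p ∈ L.1 → 𝓜.Orthogonal K L

end HyperbolaStructure

/-- A symmetric Minkowski plane is a hyperbola structure that satisfies the symmetry axiom. -/
structure SymmetricMinkowskiPlane (P : Type u) extends HyperbolaStructure P where
  symmetry_axiom : toHyperbolaStructure.SymmetryAxiom

/-!
Fix the circle `L` as a coordinate axis for both families of generators. A circle `C` is then the
graph of a permutation of `L` (`HyperbolaStructure.circlePerm`), with `L` itself the identity.
The axioms say that these permutations form a sharply 3-transitive set `Γ` in which `h⁻¹ g` is an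
involution as soon as it interchanges two distinct elements, and `K ⊥ C` means that `K⁻¹ C` is an
involution. In these terms `K` and `M` are involutions, `N` is orthogonal to both, (i') says that
`N c = K (M c) ≠ c` for some `c`, and the claim is `N = K M`.

The set where `N` agrees with `K M` is stable under `K` and `M`. Hence it has three elements, unless
a degenerate case occurs that is settled by the uniqueness of the orthogonal circle through two
points (`IsSymmetricSharp.involution_unique`). So the theorem follows once `K M` is known to be a
circle, and in fact `Γ` is a group (`IsSymmetricSharp.mul_mem`):

* `Γ` is closed under inverses (`IsSymmetricSharp.inv_mem`). The places where a circle agrees with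
  `l⁻¹` are stable under the symmetries in the circles orthogonal to `1` and `l`, and these are
  numerous enough to carry agreement from one orbit of `l` to another. By a change of the
  base circle, `k g k ∈ Γ` for all `k, g ∈ Γ`.
* The circles fixing `x` and `y` are inverted by all circles interchanging `x` and `y`. It
  follows that they form an abelian group (`IsSymmetricSharp.commute_of_fixing`,
  `IsSymmetricSharp.mul_mem_of_fixing`), and that left translation by the square of each of them
  preserves `Γ` (`IsSymmetricSharp.mul_self_mem_leftStabilizer`).
* On at most four points `Γ` consists of all permutations. On five or more points these squares
  generate a doubly transitive group. The group of all permutations whose left translation preserves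
  `Γ` (`IsSymmetricSharp.leftStabilizer`) contains it and is normalized by `Γ`. Modulo that group
  each circle becomes one that fixes two given points, and such circles are closed under
  composition.
-/

open Equiv

/-! ### Sharply 3-transitive sets of permutations with the symmetry condition -/

/-- A set of permutations that contains the identity, is sharply transitive on triples of distinct
elements, and satisfies the symmetry condition: if `h⁻¹ * g` interchanges two distinct elements,
then it is an involution. -/
structure IsSymmetricSharp {X : Type*} (Γ : Set (Perm X)) : Prop where
  one_mem : 1 ∈ Γ
  exists_mem : ∀ {a b c a' b' c' : X}, a ≠ b → b ≠ c → c ≠ a → a' ≠ b' → b' ≠ c' → c' ≠ a' →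
    ∃ g ∈ Γ, g a = a' ∧ g b = b' ∧ g c = c'
  eq_of_three : ∀ {g h : Perm X}, g ∈ Γ → h ∈ Γ → ∀ {a b c : X}, a ≠ b → b ≠ c → c ≠ a →
    g a = h a → g b = h b → g c = h c → g = h
  swap : ∀ {g h : Perm X}, g ∈ Γ → h ∈ Γ → ∀ {x y : X}, x ≠ y → g x = h y → g y = h x →
    g * h⁻¹ * g = h

namespace IsSymmetricSharp

variable {X : Type*} {Γ : Set (Perm X)}

theorem involutive_of_swap (hΓ : IsSymmetricSharp Γ) {g : Perm X} (hg : g ∈ Γ) {x y : X}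
    (hxy : x ≠ y) (h1 : g x = y) (h2 : g y = x) (z : X) : g (g z) = z := by
  have h := hΓ.swap hg hΓ.one_mem hxy (by simpa using h1) (by simpa using h2)
  simpa using DFunLike.congr_fun h z

/-- If `i` is an involution and `g` agrees with it crosswise at two points `x` and `y`, then
`i * g` is an involution as well, that is, `i` inverts `g`. -/
theorem swap_apply (hΓ : IsSymmetricSharp Γ) {g i : Perm X} (hg : g ∈ Γ) (hi : i ∈ Γ)
    (hinv : ∀ z, i (i z) = z) {x y : X} (hxy : x ≠ y) (h1 : g x = i y) (h2 : g y = i x) (z : X) :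
    g (i (g z)) = i z := by
  have h := DFunLike.congr_fun (hΓ.swap hg hi hxy h1 h2) z
  have e : i⁻¹ (g z) = i (g z) := by rw [Perm.inv_eq_iff_eq, hinv]
  rwa [Perm.mul_apply, Perm.mul_apply, e] at h

theorem exists_swap (hΓ : IsSymmetricSharp Γ) {x y z w : X} (hxy : x ≠ y) (hzx : z ≠ x)
    (hzy : z ≠ y) (hwx : w ≠ x) (hwy : w ≠ y) :
    ∃ i ∈ Γ, i x = y ∧ i y = x ∧ i z = w ∧ ∀ t, i (i t) = t := by
  obtain ⟨i, hi, h1, h2, h3⟩ := hΓ.exists_mem hxy hzy.symm hzx hxy.symm hwx.symm hwy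
  exact ⟨i, hi, h1, h2, h3, hΓ.involutive_of_swap hi hxy h1 h2⟩

/-- Any member of `Γ` may take over the role of the identity. -/
theorem preimage_mul_left (hΓ : IsSymmetricSharp Γ) {k : Perm X} (hk : k ∈ Γ) :
    IsSymmetricSharp {g | k * g ∈ Γ} where
  one_mem := by simpa using hk
  exists_mem := by
    intro a b c a' b' c' h1 h2 h3 h4 h5 h6
    obtain ⟨g, hg, e1, e2, e3⟩ := hΓ.exists_mem h1 h2 h3 (k.injective.ne h4) (k.injective.ne h5)
      (k.injective.ne h6)
    exact ⟨k⁻¹ * g, by simpa using hg, by simp [e1], by simp [e2], by simp [e3]⟩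
  eq_of_three := by
    intro g h hg hh a b c h1 h2 h3 e1 e2 e3
    exact mul_left_cancel (hΓ.eq_of_three hg hh h1 h2 h3 (by simp [e1]) (by simp [e2])
      (by simp [e3]))
  swap := by
    intro g h hg hh x y hxy e1 e2
    have := hΓ.swap hg hh hxy (by simp [e1]) (by simp [e2])
    apply mul_left_cancel (a := k)
    rw [← this]
    group

/-! ### Circle symmetries are automorphisms -/

/-- If `x` and `y` are moved by `l`, which has no `2`-cycle, then some involution `i ∈ Γ`
interchanges `x` with `l y` and `y` with `l x`; hence `i * l` interchanges `x` and `y`. -/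
theorem exists_swap_crossed (hΓ : IsSymmetricSharp Γ) {l : Perm X} (h2 : ∀ x, l (l x) = x → l x = x)
    {x y : X} (hx : l x ≠ x) (hy : l y ≠ y) (hxy : x ≠ y) :
    ∃ i ∈ Γ, i x = l y ∧ i y = l x ∧ ∀ t, i (i t) = t := by
  have hl : l x ≠ l y := l.injective.ne hxy
  by_cases h : x = l y
  · have hyx : y ≠ l x := by
      rintro e
      exact hx (h2 x (by rw [← e, ← h]))
    obtain ⟨i, hi, e1, -, e3, e4⟩ := hΓ.exists_swap hyx hxy hx.symm hy hl.symm
    exact ⟨i, hi, e3, e1, e4⟩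
  · obtain ⟨i, hi, e1, -, e3, e4⟩ := hΓ.exists_swap h hxy.symm hy.symm hx hl
    exact ⟨i, hi, e1, e3, e4⟩

/-- Suppose `q ∈ Γ` agrees with `l⁻¹` at `l x` and `l y`, and `i` interchanges `x` with `l y` and
`y` with `l x`. Then `i` is orthogonal to both `l` and `q`, so the set of places where `q` agrees
with `l⁻¹` is stable under the symmetry with respect to `i`. -/
theorem apply_crossed (hΓ : IsSymmetricSharp Γ) {l q i : Perm X} (hl : l ∈ Γ) (hq : q ∈ Γ)
    (hi : i ∈ Γ) (hinv : ∀ t, i (i t) = t) {x y w : X} (hxy : x ≠ y) (h1 : i x = l y)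
    (h2 : i y = l x) (hx : q (l x) = x) (hy : q (l y) = y) (hw : q (l w) = w) :
    q (l (i (l w))) = i (l w) := by
  have e1 := hΓ.swap_apply hl hi hinv hxy h2.symm h1.symm w
  have e2 := hΓ.swap_apply hq hi hinv (l.injective.ne hxy) (by rw [hx, ← h1, hinv])
    (by rw [hy, ← h2, hinv]) (l w)
  rw [e1]
  rwa [hw] at e2

/-- A circle agreeing with `l⁻¹` at `l c`, `l (l c)` and `l z` agrees with it at `c` as well. -/
theorem apply_prev (hΓ : IsSymmetricSharp Γ) {l q : Perm X} (hl : l ∈ Γ) (hq : q ∈ Γ)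
    (h2 : ∀ x, l (l x) = x → l x = x) {c z : X} (hc : l c ≠ c) (hz : l z ≠ z) (hzc : z ≠ c)
    (hzd : z ≠ l c) (q1 : q (l c) = c) (q2 : q (l (l c)) = l c) (q3 : q (l z) = z) :
    q c = l⁻¹ c := by
  have key : ∀ {c z : X}, c ≠ z → l c ≠ c → l z ≠ z → q (l c) = c → q (l z) = z →
      ∀ {w}, w = l c → q (l w) = w → q z = l⁻¹ z := by
    intro c z hcz hc hz q1 q3 w hw q2
    obtain ⟨i, hi, e1, e2, e3⟩ := hΓ.exists_swap_crossed h2 hc hz hcz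
    have e := hΓ.apply_crossed hl hq hi e3 hcz e1 e2 q1 q3 q2
    have e4 := hΓ.swap_apply hl hi e3 hcz e2.symm e1.symm w
    -- `i * l * i = l⁻¹` and `i (l c) = z`, so the new place of agreement is `l⁻¹ z`
    have e5 : i (l w) = l⁻¹ z := by
      rw [Perm.eq_inv_iff_eq, e4, hw, ← e2, e3]
    rw [e5] at e
    simpa using e
  have hdz : l (l c) ≠ l c := l.injective.ne hc
  -- `l⁻¹ z` and then `l z` are places of agreement; the roles of `c` and `z` can be exchanged
  have hz' : q (l (l z)) = l z := by
    obtain ⟨i, hi, e1, e2, e3⟩ := hΓ.exists_swap_crossed h2 hdz hz hzd.symm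
    have e := hΓ.apply_crossed hl hq hi e3 hzd.symm e1 e2 q2 q3 q1
    rwa [e1] at e
  exact key hzc hz hc q3 q1 rfl hz'

/-- The symmetry with respect to the circle `1` preserves the set of circles. -/
theorem inv_mem (hΓ : IsSymmetricSharp Γ) {l : Perm X} (hl : l ∈ Γ) : l⁻¹ ∈ Γ := by
  by_cases h2 : ∀ x, l (l x) = x → l x = x
  swap
  · push Not at h2
    obtain ⟨x, h, hx⟩ := h2
    have : l⁻¹ = l := by
      ext z
      rw [Perm.inv_eq_iff_eq, hΓ.involutive_of_swap hl hx h rfl]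
    rwa [this]
  by_cases h1 : l = 1
  · simpa [h1] using hΓ.one_mem
  obtain ⟨c, hc⟩ : ∃ c, l c ≠ c := by
    by_contra! h
    exact h1 (Equiv.ext h)
  have hce : l (l c) ≠ c := fun h => hc (h2 c h)
  have hde : l (l c) ≠ l c := l.injective.ne hc
  have hfc : l⁻¹ c ≠ c := by rw [Ne, Perm.inv_eq_iff_eq]; exact hc.symm
  have hfd : l⁻¹ c ≠ l c := by rw [Ne, Perm.inv_eq_iff_eq]; exact hce.symm
  obtain ⟨n, hn, n1, n2, n3⟩ := hΓ.exists_mem hc.symm hde.symm hce hfc hc.symm hfd.symm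
  have moved : ∀ z, l z ≠ z → n (l z) = z := by
    intro z hz
    by_cases hzc : z = c
    · rw [hzc, n2]
    by_cases hzd : z = l c
    · rw [hzd, n3]
    obtain ⟨q, hq, q1, q2, q3⟩ := hΓ.exists_mem hde.symm (l.injective.ne (Ne.symm hzd))
      (l.injective.ne hzc) hc.symm (Ne.symm hzd) hzc
    have := hΓ.apply_prev hl hq h2 hc hz hzc hzd q1 q2 q3
    have : n = q := hΓ.eq_of_three hn hq hc.symm hde.symm hce (by rw [n1, this])
      (by rw [n2, q1]) (by rw [n3, q2])
    rw [this, q3]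
  have fixed : ∀ z, l z = z → n z = z := by
    intro z hz
    by_contra hnz
    have hz' : l (n z) = n z := by
      by_contra h
      exact hnz (l.injective ((n.injective (moved _ h)).trans hz.symm))
    have hnn : n (n z) = z := by
      by_contra h
      have hz'' : l (n (n z)) = n (n z) := by
        by_contra h
        exact hnz (n.injective (l.injective ((n.injective (moved _ h)).trans hz'.symm)))
      exact h1 (hΓ.eq_of_three hl hΓ.one_mem (Ne.symm hnz)
        (n.injective.ne (Ne.symm hnz)) h hz hz' hz'')
    -- `n` interchanges the two fixed elements of `l`, so it is an involution
    have := hΓ.involutive_of_swap hn (Ne.symm hnz) rfl hnn (l c)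
    rw [n2, n1] at this
    exact hfd this
  have : l⁻¹ = n := by
    ext z
    rw [Perm.inv_eq_iff_eq]
    by_cases h : l (n z) = n z
    · by_cases h' : l z = z
      · rw [fixed z h', h']
      · have hf := fixed _ h
        rw [n.injective hf] at h
        exact absurd h h'
    · exact (n.injective (moved _ h)).symm
  rwa [this]

/-- The composite `g ↦ k * g * k` of the symmetries with respect to `1` and to `k` preserves the set
of circles, since each of them does. -/
theorem mul_mul_mem (hΓ : IsSymmetricSharp Γ) {k g : Perm X} (hk : k ∈ Γ) (hg : g ∈ Γ) :
    k * g * k ∈ Γ := by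
  have h := (hΓ.preimage_mul_left hk).inv_mem (l := k⁻¹ * g⁻¹)
    (by simpa using hΓ.inv_mem hg)
  simpa [mul_assoc] using h

/-! ### Circles through two points -/

/-- A circle fixing `x` and `y` is inverted by every circle interchanging them. -/
theorem apply_swap_apply (hΓ : IsSymmetricSharp Γ) {a b : Perm X} (ha : a ∈ Γ) (hb : b ∈ Γ)
    {x y : X} (hxy : x ≠ y) (ax : a x = x) (ay : a y = y) (bx : b x = y) (b_y : b y = x) (z : X) :
    a (b (a z)) = b z :=
  hΓ.swap_apply ha hb (hΓ.involutive_of_swap hb hxy bx b_y) hxy (by rw [ax, b_y])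
    (by rw [ay, bx]) z

theorem exists_fixing (hΓ : IsSymmetricSharp Γ) {x y z w : X} (hxy : x ≠ y) (hzx : z ≠ x)
    (hzy : z ≠ y) (hwx : w ≠ x) (hwy : w ≠ y) : ∃ a ∈ Γ, a x = x ∧ a y = y ∧ a z = w :=
  hΓ.exists_mem hxy hzy.symm hzx hxy hwy.symm hwx

/-- Circles through two common points commute: `a (c z) = c (a z)` is read off from the circle that
interchanges `x` with `y` and `a z` with `c z`. -/
theorem commute_of_fixing (hΓ : IsSymmetricSharp Γ) {a c : Perm X} (ha : a ∈ Γ) (hc : c ∈ Γ)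
    {x y : X} (hxy : x ≠ y) (ax : a x = x) (ay : a y = y) (cx : c x = x) (cy : c y = y) :
    a * c = c * a := by
  ext z
  simp only [Perm.mul_apply]
  by_cases hzx : z = x
  · simp [hzx, ax, cx]
  by_cases hzy : z = y
  · simp [hzy, ay, cy]
  have ne : ∀ {g : Perm X}, g x = x → g y = y → g z ≠ x ∧ g z ≠ y := fun gx gy =>
    ⟨fun h => hzx (by rwa [← gx, EmbeddingLike.apply_eq_iff_eq] at h),
      fun h => hzy (by rwa [← gy, EmbeddingLike.apply_eq_iff_eq] at h)⟩
  obtain ⟨b, hb, bx, b_y, bz, hinv⟩ :=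
    hΓ.exists_swap hxy (ne ax ay).1 (ne ax ay).2 (ne cx cy).1 (ne cx cy).2
  have e1 := hΓ.apply_swap_apply ha hb hxy ax ay bx b_y z
  have e2 := hΓ.apply_swap_apply hc hb hxy cx cy bx b_y z
  rw [bz] at e1
  rw [← bz, hinv] at e2
  rw [e1, e2]

/-- The circles through two given points are closed under composition. -/
theorem mul_mem_of_fixing (hΓ : IsSymmetricSharp Γ) {a c : Perm X} (ha : a ∈ Γ) (hc : c ∈ Γ)
    {x y z : X} (hxy : x ≠ y) (hzx : z ≠ x) (hzy : z ≠ y) (ax : a x = x) (ay : a y = y)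
    (cx : c x = x) (cy : c y = y) : a * c ∈ Γ := by
  have hx : a (c z) ≠ x := fun h => hzx (by
    rwa [← ax, EmbeddingLike.apply_eq_iff_eq, ← cx, EmbeddingLike.apply_eq_iff_eq] at h)
  have hy : a (c z) ≠ y := fun h => hzy (by
    rwa [← ay, EmbeddingLike.apply_eq_iff_eq, ← cy, EmbeddingLike.apply_eq_iff_eq] at h)
  obtain ⟨d, hd, dx, dy, dz⟩ := hΓ.exists_fixing hxy hzx hzy hx hy
  have : a * c = d := by
    ext w
    by_cases hwx : w = x
    · simp [hwx, cx, ax, dx]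
    by_cases hwy : w = y
    · simp [hwy, cy, ay, dy]
    obtain ⟨e, he, ex, ey, rfl⟩ := hΓ.exists_fixing hxy hzx hzy hwx hwy
    have h1 := DFunLike.congr_fun (hΓ.commute_of_fixing hc he hxy cx cy ex ey) z
    have h2 := DFunLike.congr_fun (hΓ.commute_of_fixing ha he hxy ax ay ex ey) (c z)
    have h3 := DFunLike.congr_fun (hΓ.commute_of_fixing hd he hxy dx dy ex ey) z
    simp only [Perm.mul_apply] at h1 h2 h3 ⊢
    rw [h1, h2, h3, dz]
  rwa [this]

theorem mul_mem_of_fixing_of_swap (hΓ : IsSymmetricSharp Γ) {a b : Perm X} (ha : a ∈ Γ)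
    (hb : b ∈ Γ) {x y z : X} (hxy : x ≠ y) (hzx : z ≠ x) (hzy : z ≠ y) (ax : a x = x)
    (ay : a y = y) (bx : b x = y) (b_y : b y = x) : a * b ∈ Γ := by
  have hx : a (b z) ≠ x := fun h => hzy (by
    rwa [← ax, EmbeddingLike.apply_eq_iff_eq, ← b_y, EmbeddingLike.apply_eq_iff_eq] at h)
  have hy : a (b z) ≠ y := fun h => hzx (by
    rwa [← ay, EmbeddingLike.apply_eq_iff_eq, ← bx, EmbeddingLike.apply_eq_iff_eq] at h)
  obtain ⟨d, hd, dx, dy, dz, -⟩ := hΓ.exists_swap hxy hzx hzy hx hy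
  have : a * b = d := by
    ext w
    by_cases hwx : w = x
    · simp [hwx, bx, ay, dx]
    by_cases hwy : w = y
    · simp [hwy, b_y, ax, dy]
    obtain ⟨e, he, ex, ey, rfl⟩ := hΓ.exists_fixing hxy hzx hzy hwx hwy
    have h1 := hΓ.apply_swap_apply he hb hxy ex ey bx b_y z
    have h2 := DFunLike.congr_fun (hΓ.commute_of_fixing ha he hxy ax ay ex ey) (b (e z))
    have h3 := hΓ.apply_swap_apply he hd hxy ex ey dx dy z
    simp only [Perm.mul_apply] at h2 ⊢
    apply e.injective
    rw [← h2, h1, h3, dz]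
  rwa [this]

/-- At most one circle through two given points of the circle `1` is orthogonal to it: if `s` and
`t` were different such involutions, then the circle `b` interchanging `x` and `y` and fixing `z`
would also fix `s z` and `t z`. -/
theorem involution_unique (hΓ : IsSymmetricSharp Γ) {s t : Perm X} (hs : s ∈ Γ) (ht : t ∈ Γ)
    {x y z : X} (hxy : x ≠ y) (hzx : z ≠ x) (hzy : z ≠ y) (sx : s x = x) (sy : s y = y)
    (tx : t x = x) (ty : t y = y) (s2 : ∀ w, s (s w) = w) (t2 : ∀ w, t (t w) = w)
    (s1 : s ≠ 1) (t1 : t ≠ 1) : s = t := by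
  by_contra hst
  obtain ⟨b, hb, bx, b_y, bz, -⟩ := hΓ.exists_swap hxy hzx hzy hzx hzy
  have fix : ∀ {g : Perm X}, g ∈ Γ → g x = x → g y = y → (∀ w, g (g w) = w) → b (g z) = g z := by
    intro g hg gx gy g2
    apply g.injective
    rw [hΓ.apply_swap_apply hg hb hxy gx gy bx b_y z, bz, g2]
  have h1 : z ≠ s z := fun h =>
    s1 (hΓ.eq_of_three hs hΓ.one_mem hxy hzy.symm hzx sx sy h.symm)
  have h2 : s z ≠ t z := fun h => hst (hΓ.eq_of_three hs ht hxy hzy.symm hzx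
    (by rw [sx, tx]) (by rw [sy, ty]) h)
  have h3 : t z ≠ z := fun h => t1 (hΓ.eq_of_three ht hΓ.one_mem hxy hzy.symm hzx tx ty h)
  have : b = 1 := hΓ.eq_of_three hb hΓ.one_mem h1 h2 h3 bz (fix hs sx sy s2) (fix ht tx ty t2)
  rw [this] at bx
  exact hxy bx

/-! ### The circles form a group -/

/-- The permutations whose left translation preserves the set `Γ`. -/
def leftStabilizer (Γ : Set (Perm X)) : Subgroup (Perm X) where
  carrier := {h | ∀ g, h * g ∈ Γ ↔ g ∈ Γ}
  one_mem' := by simp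
  mul_mem' := by
    intro h k hh hk g
    rw [mul_assoc, hh, hk]
  inv_mem' := by
    intro h hh g
    rw [← hh, mul_inv_cancel_left]

theorem conj_mem_leftStabilizer (hΓ : IsSymmetricSharp Γ) {h k : Perm X}
    (hh : h ∈ leftStabilizer Γ) (hk : k ∈ Γ) : k * h * k⁻¹ ∈ leftStabilizer Γ := by
  have key : ∀ h' ∈ leftStabilizer Γ, ∀ g ∈ Γ, k * h' * k⁻¹ * g ∈ Γ := by
    intro h' hh' g hg
    have e := hΓ.mul_mul_mem hk ((hh' _).2 (hΓ.mul_mul_mem (hΓ.inv_mem hk) hg))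
    simpa [mul_assoc] using e
  intro g
  refine ⟨fun hg => ?_, key h hh g⟩
  have := key h⁻¹ (Subgroup.inv_mem _ hh) _ hg
  simpa [mul_assoc] using this

/-- With `b` interchanging `x` and `y`, the composite of the symmetry products belonging to `a`, `b`
and the involution `a * b` is left translation by `a * a`. -/
theorem mul_self_mem_leftStabilizer (hΓ : IsSymmetricSharp Γ) {a : Perm X} (ha : a ∈ Γ)
    {x y z : X} (hxy : x ≠ y) (hzx : z ≠ x) (hzy : z ≠ y) (ax : a x = x) (ay : a y = y) :
    a * a ∈ leftStabilizer Γ := by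
  have key : ∀ a ∈ Γ, a x = x → a y = y → ∀ g ∈ Γ, a * a * g ∈ Γ := by
    intro a ha ax ay g hg
    obtain ⟨b, hb, bx, b_y, -, b2⟩ := hΓ.exists_swap hxy hzx hzy hzx hzy
    have hab := hΓ.mul_mem_of_fixing_of_swap ha hb hxy hzx hzy ax ay bx b_y
    have h := hΓ.mul_mul_mem hab (hΓ.mul_mul_mem hb (hΓ.mul_mul_mem ha hg))
    have e : a * b * (b * (a * g * a) * b) * (a * b) = a * a * g := by
      ext w
      simp only [Perm.mul_apply, b2]
      rw [hΓ.apply_swap_apply ha hb hxy ax ay bx b_y, b2]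
    rwa [e] at h
  intro g
  refine ⟨fun hg => ?_, key a ha ax ay g⟩
  have inv_fix : ∀ {w}, a w = w → a⁻¹ w = w := fun h => by rw [Perm.inv_eq_iff_eq, h]
  have := key a⁻¹ (hΓ.inv_mem ha) (inv_fix ax) (inv_fix ay) _ hg
  simpa [mul_assoc] using this

/-- On at most four points `Γ` consists of all permutations, being transitive on triples. -/
theorem exists_ne_of_notMem (hΓ : IsSymmetricSharp Γ) {σ : Perm X} (hσ : σ ∉ Γ) {p u v : X}
    (hpu : p ≠ u) (huv : u ≠ v) (hvp : v ≠ p) :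
    ∃ w w', w ≠ w' ∧ (w ≠ p ∧ w ≠ u ∧ w ≠ v) ∧ (w' ≠ p ∧ w' ≠ u ∧ w' ≠ v) := by
  obtain ⟨g, hg, gp, gu, gv⟩ := hΓ.exists_mem hpu huv hvp (σ.injective.ne hpu)
    (σ.injective.ne huv) (σ.injective.ne hvp)
  obtain ⟨w, hw⟩ : ∃ w, g w ≠ σ w := by
    by_contra! h
    exact hσ (Equiv.ext h ▸ hg)
  have hne : ∀ {t}, g t = σ t → w ≠ t ∧ σ⁻¹ (g w) ≠ t := by
    intro t ht
    have hwt : w ≠ t := by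
      rintro rfl
      exact hw ht
    refine ⟨hwt, fun h => hwt ?_⟩
    rwa [Perm.inv_eq_iff_eq, ← ht, EmbeddingLike.apply_eq_iff_eq] at h
  refine ⟨w, σ⁻¹ (g w), fun h => hw ?_, ⟨(hne gp).1, (hne gu).1, (hne gv).1⟩,
    ⟨(hne gp).2, (hne gu).2, (hne gv).2⟩⟩
  rw [eq_comm, Perm.inv_eq_iff_eq] at h
  exact h

/-- On at least five points, the stabilizer of a point `p` in `leftStabilizer Γ` is transitive on the
other points. The permutation `σ ∉ Γ` guarantees that there are enough points. The permutation taking `u` to `v` is the square of a circle `a` with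
`u ↦ w ↦ v` which fixes `p` and a second point. -/
theorem exists_mem_leftStabilizer_fixing (hΓ : IsSymmetricSharp Γ) {σ : Perm X} (hσ : σ ∉ Γ)
    {p u v : X} (hpu : p ≠ u) (hvp : v ≠ p) :
    ∃ h ∈ leftStabilizer Γ, h p = p ∧ h u = v := by
  by_cases huv : u = v
  · exact ⟨1, Subgroup.one_mem _, rfl, huv⟩
  obtain ⟨i, hi, iu, iv, ip, -⟩ := hΓ.exists_swap huv hpu hvp.symm hpu hvp.symm
  obtain ⟨w, ⟨wp, wu, wv⟩, iw⟩ : ∃ w, (w ≠ p ∧ w ≠ u ∧ w ≠ v) ∧ i w ≠ w := by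
    obtain ⟨w, w', hww, hw, hw'⟩ := hΓ.exists_ne_of_notMem hσ hpu huv hvp
    by_contra! h
    have : i = 1 := hΓ.eq_of_three hi hΓ.one_mem hw.1.symm hww hw'.1 ip (h w hw) (h w' hw')
    rw [this] at iu
    exact huv iu
  obtain ⟨a, ha, ap, au, aw⟩ := hΓ.exists_mem hpu wu.symm wp wp.symm wv hvp
  obtain ⟨r, hr, ar⟩ : ∃ r, r ≠ p ∧ a r = r := by
    by_contra! h
    -- `a` is inverted by the involution `u ↔ v` fixing `w`, which then fixes `p` and hence is `i`
    obtain ⟨j, hj, ju, jv, jw, j2⟩ := hΓ.exists_swap huv wu wv wu wv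
    have e := hΓ.swap_apply ha hj j2 wu.symm (by rw [au, jw]) (by rw [aw, ju]) p
    rw [ap] at e
    have jp : j p = p := by
      by_contra hjp
      exact h _ hjp e
    have : i = j := hΓ.eq_of_three hi hj hpu huv hvp (by rw [ip, jp]) (by rw [iu, ju])
      (by rw [iv, jv])
    exact iw (this ▸ jw)
  have hur : u ≠ r := by
    rintro rfl
    exact wu (au.symm.trans ar)
  exact ⟨a * a, hΓ.mul_self_mem_leftStabilizer ha hr.symm hpu.symm hur ap ar, by simp [ap],
    by simp [au, aw]⟩

theorem exists_mem_leftStabilizer (hΓ : IsSymmetricSharp Γ) {σ : Perm X} (hσ : σ ∉ Γ)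
    {x y z x' y' : X} (hxy : x ≠ y) (hyz : y ≠ z) (hzx : z ≠ x) (hxy' : x' ≠ y') :
    ∃ h ∈ leftStabilizer Γ, h x = x' ∧ h y = y' := by
  obtain ⟨r, hrx, hrx'⟩ : ∃ r, r ≠ x ∧ r ≠ x' := by
    by_cases h : y = x'
    · exact ⟨z, hzx, h ▸ hyz.symm⟩
    · exact ⟨y, hxy.symm, h⟩
  obtain ⟨h, hh, -, hx⟩ := hΓ.exists_mem_leftStabilizer_fixing hσ hrx hrx'.symm
  have hne : x' ≠ h y := hx ▸ h.injective.ne hxy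
  obtain ⟨k, hk, kx, ky⟩ := hΓ.exists_mem_leftStabilizer_fixing hσ hne hxy'.symm
  exact ⟨k * h, Subgroup.mul_mem _ hk hh, by simp [hx, kx], by simp [ky]⟩

/-- The set of circles is a group: modulo `leftStabilizer Γ`, every circle is one that fixes two
given points. -/
theorem mul_mem (hΓ : IsSymmetricSharp Γ) {x y z : X} (hxy : x ≠ y) (hyz : y ≠ z) (hzx : z ≠ x)
    {g k : Perm X} (hg : g ∈ Γ) (hk : k ∈ Γ) : g * k ∈ Γ := by
  by_contra hgk
  have decomp : ∀ g ∈ Γ, ∃ h ∈ leftStabilizer Γ, ∃ a ∈ Γ, a x = x ∧ a y = y ∧ g = h * a := by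
    intro g hg
    obtain ⟨h, hh, hx, hy⟩ := hΓ.exists_mem_leftStabilizer hgk hxy hyz hzx (g.injective.ne hxy)
    exact ⟨h, hh, h⁻¹ * g, (Subgroup.inv_mem _ hh g).2 hg, by simp [← hx], by simp [← hy], by simp⟩
  obtain ⟨h, hh, a, ha, ax, ay, rfl⟩ := decomp g hg
  obtain ⟨h', hh', a', ha', ax', ay', rfl⟩ := decomp k hk
  have haa := hΓ.mul_mem_of_fixing ha ha' hxy hzx hyz.symm ax ay ax' ay'
  have := (hh _).2 ((hΓ.conj_mem_leftStabilizer hh' ha _).2 haa)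
  apply hgk
  simpa [mul_assoc] using this

/-! ### Two pairs of mutually orthogonal circles -/

/-- Let `k`, `m` be involutions, and let `n` be orthogonal to both. The set where `n` agrees with
`k * m` is stable under `k` and `m`; if it contains an element `c` with `n c ≠ c`, it
has three elements, or `k`, `m`, `n` preserve the pair `{c, n c}`. -/
theorem eq_mul_of_apply_eq (hΓ : IsSymmetricSharp Γ) {x y z : X} (hxy : x ≠ y) (hyz : y ≠ z)
    (hzx : z ≠ x) {k m n : Perm X} (hk : k ∈ Γ) (hm : m ∈ Γ) (hn : n ∈ Γ)
    (k2 : ∀ t, k (k t) = t) (m2 : ∀ t, m (m t) = t) (hk1 : k ≠ 1) (hm1 : m ≠ 1) (hkn : k ≠ n)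
    (hmn : m ≠ n) (nk : ∀ t, n (k (n t)) = k t) (nm : ∀ t, n (m (n t)) = m t) {c : X}
    (hc : n c = k (m c)) (hcn : n c ≠ c) : n = k * m := by
  have hkm := hΓ.mul_mem hxy hyz hzx hk hm
  have stab_m : ∀ {t}, n t = k (m t) → n (m t) = k (m (m t)) := by
    intro t ht
    have := nk t
    rw [ht, k2] at this
    rw [m2, this]
  have stab_d : ∀ {t}, n t = k (m t) → n (n t) = k (m (n t)) := by
    intro t ht
    have h1 := nm t
    rw [ht] at h1
    have h2 := stab_m (t := m (k (m t))) (by rw [h1, m2, k2])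
    rwa [m2, ← ht] at h2
  have hd := stab_d hc
  have three : ∀ {t}, n t = k (m t) → t ≠ c → t ≠ n c → n = k * m := fun ht h1 h2 =>
    hΓ.eq_of_three hn hkm hcn.symm (Ne.symm h2) h1 hc hd ht
  obtain ⟨r, hrc, hrn⟩ : ∃ r, r ≠ c ∧ r ≠ n c := by
    by_contra! h
    by_cases h1 : x = c
    · exact hyz ((h y (h1 ▸ hxy.symm)).trans (h z (h1 ▸ hzx)).symm)
    by_cases h2 : y = c
    · exact hzx ((h z (h2 ▸ hyz.symm)).trans (h x h1).symm)
    · exact hxy ((h x h1).trans (h y h2).symm)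
  have inv_mul : ∀ {i : Perm X}, (∀ t, i (i t) = t) → (∀ t, n (i (n t)) = i t) →
      ∀ t, (i * n) ((i * n) t) = t := by
    intro i i2 ni t
    simp [ni, i2]
  have ne_one : ∀ {i : Perm X}, (∀ t, i (i t) = t) → i ≠ n → i * n ≠ 1 := by
    intro i i2 hi h
    apply hi
    ext t
    have := DFunLike.congr_fun h t
    simp only [Perm.mul_apply, Perm.one_apply] at this
    rw [← this, i2, this]
  by_cases h1 : m c = c
  · -- `m` fixes `c` and `n c`, while `k` and `n` interchange them
    by_cases h2 : m (n c) = n c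
    · have hkc : k c = n c := by rw [hc, h1]
      have hkd : k (n c) = c := by rw [← hkc, k2]
      have hnd : n (n c) = c := by rw [hd, h2, hkd]
      have hknm := hΓ.mul_mem hxy hyz hzx hk hn
      have : k * n = m := hΓ.involution_unique hknm hm hcn.symm hrc hrn (by simp [hkd])
        (by simp [hnd, hkc]) h1 h2 (inv_mul k2 nk) m2 (ne_one k2 hkn) hm1
      rw [← this]
      ext t
      simp [k2]
    · exact three (stab_m hd) (fun h => hcn (by rw [← m2 (n c), h, h1])) h2
  · by_cases h2 : m c = n c
    · -- `k` fixes `c` and `n c`, while `m` and `n` interchange them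
      have hkd : k (n c) = n c := by rw [← h2, ← hc, h2]
      have hmd : m (n c) = c := by rw [← h2, m2]
      have hnd : n (n c) = k c := by rw [hd, hmd]
      by_cases h3 : k c = c
      · have hmnm := hΓ.mul_mem hxy hyz hzx hm hn
        have e : m * n = k := hΓ.involution_unique hmnm hk hcn.symm hrc hrn (by simp [hmd])
          (by simp [hnd, h3, h2]) h3 hkd (inv_mul m2 nm) k2 (ne_one m2 hmn) hk1
        have e1 : n = m * k := by
          rw [← e]
          ext t
          simp [m2]
        ext t
        have := hΓ.apply_swap_apply hk hm hcn.symm h3 hkd h2 hmd (k t)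
        rw [k2] at this
        rw [e1, Perm.mul_apply, Perm.mul_apply, this]
      · exact three (t := k c) (hnd ▸ stab_d hd) h3 (fun h => hcn (by rw [← hkd, ← h, k2]))
    · exact three (stab_m hc) h1 h2

end IsSymmetricSharp

/-! ### Circles of a hyperbola structure as permutations -/

namespace HyperbolaStructure

variable {P : Type*} (𝓜 : HyperbolaStructure P)

theorem mem_cls₁_iff {p q : P} : q ∈ 𝓜.cls₁ p ↔ 𝓜.cls₁ q = 𝓜.cls₁ p :=
  ⟨𝓜.cls₁_eq_of_mem, fun h => h ▸ 𝓜.self_mem_cls₁ q⟩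

theorem mem_cls₂_iff {p q : P} : q ∈ 𝓜.cls₂ p ↔ 𝓜.cls₂ q = 𝓜.cls₂ p :=
  ⟨𝓜.cls₂_eq_of_mem, fun h => h ▸ 𝓜.self_mem_cls₂ q⟩

theorem cls₁_meet (p q : P) : 𝓜.cls₁ (𝓜.meet p q) = 𝓜.cls₁ p :=
  𝓜.cls₁_eq_of_mem (𝓜.meet_mem p q).1

theorem cls₂_meet (p q : P) : 𝓜.cls₂ (𝓜.meet p q) = 𝓜.cls₂ q :=
  𝓜.cls₂_eq_of_mem (𝓜.meet_mem p q).2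

theorem cls₁_proj₁ (p : P) (K : 𝓜.Circle) : 𝓜.cls₁ (𝓜.proj₁ p K) = 𝓜.cls₁ p :=
  𝓜.cls₁_eq_of_mem (𝓜.proj₁_mem p K).1

theorem cls₂_proj₂ (p : P) (K : 𝓜.Circle) : 𝓜.cls₂ (𝓜.proj₂ K p) = 𝓜.cls₂ p :=
  𝓜.cls₂_eq_of_mem (𝓜.proj₂_mem K p).1

theorem eq_of_cls_eq {p q : P} (h1 : 𝓜.cls₁ p = 𝓜.cls₁ q) (h2 : 𝓜.cls₂ p = 𝓜.cls₂ q) : p = q :=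
  (𝓜.exists_unique_meet q q).unique ⟨𝓜.mem_cls₁_iff.2 h1, 𝓜.mem_cls₂_iff.2 h2⟩
    ⟨𝓜.self_mem_cls₁ q, 𝓜.self_mem_cls₂ q⟩

theorem eq_of_cls₁_eq {K : 𝓜.Circle} {p q : P} (hp : p ∈ K.1) (hq : q ∈ K.1)
    (h : 𝓜.cls₁ p = 𝓜.cls₁ q) : p = q :=
  (𝓜.exists_unique_proj₁ q K).unique ⟨𝓜.mem_cls₁_iff.2 h, hp⟩ ⟨𝓜.self_mem_cls₁ q, hq⟩

theorem eq_of_cls₂_eq {K : 𝓜.Circle} {p q : P} (hp : p ∈ K.1) (hq : q ∈ K.1)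
    (h : 𝓜.cls₂ p = 𝓜.cls₂ q) : p = q :=
  (𝓜.exists_unique_proj₂ K q).unique ⟨𝓜.mem_cls₂_iff.2 h, hp⟩ ⟨𝓜.self_mem_cls₂ q, hq⟩

/-- The first coordinate of a point `p`, the base circle `L` serving as coordinate axis for both
families of generators. -/
noncomputable def fstCoord (L : 𝓜.Circle) (p : P) : L.1 := ⟨𝓜.proj₁ p L, (𝓜.proj₁_mem p L).2⟩

/-- The second coordinate of a point `p`, with the base circle `L` as coordinate axis. -/
noncomputable def sndCoord (L : 𝓜.Circle) (p : P) : L.1 := ⟨𝓜.proj₂ L p, (𝓜.proj₂_mem L p).2⟩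

variable (L : 𝓜.Circle)

theorem cls₁_fstCoord (p : P) : 𝓜.cls₁ (𝓜.fstCoord L p : P) = 𝓜.cls₁ p := 𝓜.cls₁_proj₁ p L

theorem cls₂_sndCoord (p : P) : 𝓜.cls₂ (𝓜.sndCoord L p : P) = 𝓜.cls₂ p := 𝓜.cls₂_proj₂ p L

theorem fstCoord_eq_iff {p : P} {x : L.1} : 𝓜.fstCoord L p = x ↔ 𝓜.cls₁ p = 𝓜.cls₁ (x : P) :=
  ⟨fun h => by rw [← h, cls₁_fstCoord], fun h => Subtype.ext
    (𝓜.eq_of_cls₁_eq (K := L) (Subtype.prop _) x.2 ((𝓜.cls₁_fstCoord L p).trans h))⟩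

theorem sndCoord_eq_iff {p : P} {x : L.1} : 𝓜.sndCoord L p = x ↔ 𝓜.cls₂ p = 𝓜.cls₂ (x : P) :=
  ⟨fun h => by rw [← h, cls₂_sndCoord], fun h => Subtype.ext
    (𝓜.eq_of_cls₂_eq (K := L) (Subtype.prop _) x.2 ((𝓜.cls₂_sndCoord L p).trans h))⟩

@[simp] theorem fstCoord_meet (x y : L.1) : 𝓜.fstCoord L (𝓜.meet x y) = x :=
  (𝓜.fstCoord_eq_iff L).2 (𝓜.cls₁_meet _ _)

@[simp] theorem sndCoord_meet (x y : L.1) : 𝓜.sndCoord L (𝓜.meet x y) = y :=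
  (𝓜.sndCoord_eq_iff L).2 (𝓜.cls₂_meet _ _)

/-- The circle `C` as the graph of a permutation of the base circle `L`: it takes the first
coordinate of each point of `C` to the second. -/
noncomputable def circlePerm (C : 𝓜.Circle) : Perm L.1 where
  toFun x := 𝓜.sndCoord L (𝓜.proj₁ x C)
  invFun y := 𝓜.fstCoord L (𝓜.proj₂ C y)
  left_inv x := by
    have : 𝓜.proj₂ C (𝓜.sndCoord L (𝓜.proj₁ x C)) = 𝓜.proj₁ x C :=
      𝓜.eq_of_cls₂_eq (K := C) (𝓜.proj₂_mem _ _).2 (𝓜.proj₁_mem _ _).2 (by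
        rw [cls₂_proj₂, cls₂_sndCoord])
    dsimp only
    rw [this, fstCoord_eq_iff, cls₁_proj₁]
  right_inv y := by
    have : 𝓜.proj₁ (𝓜.fstCoord L (𝓜.proj₂ C y)) C = 𝓜.proj₂ C y :=
      𝓜.eq_of_cls₁_eq (K := C) (𝓜.proj₁_mem _ _).2 (𝓜.proj₂_mem _ _).2 (by
        rw [cls₁_proj₁, cls₁_fstCoord])
    dsimp only
    rw [this, sndCoord_eq_iff, cls₂_proj₂]

theorem circlePerm_apply (C : 𝓜.Circle) (x : L.1) :
    𝓜.circlePerm L C x = 𝓜.sndCoord L (𝓜.proj₁ x C) := rfl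

theorem mem_iff_circlePerm {C : 𝓜.Circle} {p : P} :
    p ∈ C.1 ↔ 𝓜.circlePerm L C (𝓜.fstCoord L p) = 𝓜.sndCoord L p := by
  rw [circlePerm_apply, sndCoord_eq_iff, cls₂_sndCoord]
  have h1 : 𝓜.cls₁ (𝓜.proj₁ (𝓜.fstCoord L p) C) = 𝓜.cls₁ p := by
    rw [cls₁_proj₁, cls₁_fstCoord]
  have h2 := (𝓜.proj₁_mem (𝓜.fstCoord L p) C).2
  constructor
  · intro hp
    rw [𝓜.eq_of_cls₁_eq h2 hp h1]
  · intro h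
    rwa [𝓜.eq_of_cls_eq h1 h] at h2

theorem meet_mem_iff_circlePerm {C : 𝓜.Circle} {x y : L.1} :
    𝓜.meet x y ∈ C.1 ↔ 𝓜.circlePerm L C x = y := by
  rw [𝓜.mem_iff_circlePerm L, fstCoord_meet, sndCoord_meet]

theorem circlePerm_injective : Function.Injective (𝓜.circlePerm L) := by
  intro C D h
  apply Subtype.ext
  ext p
  rw [𝓜.mem_iff_circlePerm L, 𝓜.mem_iff_circlePerm L, h]

theorem circlePerm_self : 𝓜.circlePerm L L = 1 := by
  ext x
  have : 𝓜.proj₁ x L = x :=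
    𝓜.eq_of_cls₁_eq (K := L) (𝓜.proj₁_mem _ _).2 x.2 (𝓜.cls₁_proj₁ _ _)
  rw [circlePerm_apply, this, Perm.one_apply]
  exact congrArg _ ((𝓜.sndCoord_eq_iff L).2 rfl)

theorem symm_meet (K : 𝓜.Circle) (x y : L.1) :
    𝓜.symm K (𝓜.meet x y) =
      𝓜.meet ((𝓜.circlePerm L K)⁻¹ y : L.1) (𝓜.circlePerm L K x : L.1) := by
  refine (𝓜.exists_unique_isSymmetric K (𝓜.meet x y)).unique
    (𝓜.exists_unique_isSymmetric K _).choose_spec.1 ⟨?_, ?_⟩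
  all_goals
    rw [𝓜.mem_iff_circlePerm L, (𝓜.fstCoord_eq_iff L).2 ((𝓜.cls₁_meet _ _).trans (𝓜.cls₁_meet _ _)),
      (𝓜.sndCoord_eq_iff L).2 ((𝓜.cls₂_meet _ _).trans (𝓜.cls₂_meet _ _))]
  exact (𝓜.circlePerm L K).apply_symm_apply y

/-- If `K` and `C` are orthogonal, then `K⁻¹ C` is an involution; as an identity without a preferred
base circle this reads `C K⁻¹ C = K`. -/
theorem Orthogonal.circlePerm_mul {𝓜 : HyperbolaStructure P} {K C : 𝓜.Circle}
    (h : 𝓜.Orthogonal K C) (L : 𝓜.Circle) :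
    𝓜.circlePerm L C * (𝓜.circlePerm L K)⁻¹ * 𝓜.circlePerm L C = 𝓜.circlePerm L K := by
  ext x
  have := h.2 _ ((𝓜.meet_mem_iff_circlePerm L (x := x)).2 rfl)
  rw [symm_meet, meet_mem_iff_circlePerm] at this
  exact congrArg _ this

theorem exists_three_mem : ∃ x y z : L.1, x ≠ y ∧ y ≠ z ∧ z ≠ x := by
  obtain ⟨C, hC, a, ha, b, hb, c, hc, hab, hbc, hca⟩ := 𝓜.exists_three_points
  have ne : ∀ {p q : P}, p ∈ C → q ∈ C → p ≠ q → 𝓜.fstCoord L p ≠ 𝓜.fstCoord L q := by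
    intro p q hp hq hpq h
    rw [fstCoord_eq_iff, cls₁_fstCoord] at h
    exact hpq (𝓜.eq_of_cls₁_eq (K := ⟨C, hC⟩) hp hq h)
  exact ⟨_, _, _, ne ha hb hab, ne hb hc hbc, ne hc ha hca⟩

theorem cls₁_meet_ne {x y x' y' : L.1} (hxy : x ≠ y) :
    𝓜.cls₁ (𝓜.meet x x') ≠ 𝓜.cls₁ (𝓜.meet y y') := by
  rw [cls₁_meet, cls₁_meet]
  exact fun h => hxy (Subtype.ext (𝓜.eq_of_cls₁_eq x.2 y.2 h))

theorem cls₂_meet_ne {x y x' y' : L.1} (hxy : x' ≠ y') :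
    𝓜.cls₂ (𝓜.meet x x') ≠ 𝓜.cls₂ (𝓜.meet y y') := by
  rw [cls₂_meet, cls₂_meet]
  exact fun h => hxy (Subtype.ext (𝓜.eq_of_cls₂_eq x'.2 y'.2 h))

theorem isSymmetricSharp (hS : 𝓜.SymmetryAxiom) :
    IsSymmetricSharp (Set.range (𝓜.circlePerm L)) where
  one_mem := ⟨L, 𝓜.circlePerm_self L⟩
  exists_mem := by
    intro a b c a' b' c' h1 h2 h3 h4 h5 h6
    obtain ⟨C, ⟨hC, ha, hb, hc⟩, -⟩ := 𝓜.exists_unique_circle (𝓜.meet a a') (𝓜.meet b b')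
      (𝓜.meet c c') (𝓜.cls₁_meet_ne L h1) (𝓜.cls₁_meet_ne L h2)
      (𝓜.cls₁_meet_ne L h3) (𝓜.cls₂_meet_ne L h4) (𝓜.cls₂_meet_ne L h5) (𝓜.cls₂_meet_ne L h6)
    exact ⟨_, ⟨⟨C, hC⟩, rfl⟩, (𝓜.meet_mem_iff_circlePerm L).1 ha,
      (𝓜.meet_mem_iff_circlePerm L).1 hb, (𝓜.meet_mem_iff_circlePerm L).1 hc⟩
  eq_of_three := by
    rintro _ _ ⟨C, rfl⟩ ⟨D, rfl⟩ a b c h1 h2 h3 e1 e2 e3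
    have ne : ∀ {x y : L.1}, x ≠ y → 𝓜.circlePerm L C x ≠ 𝓜.circlePerm L C y :=
      fun h => (𝓜.circlePerm L C).injective.ne h
    congr 1
    apply Subtype.ext
    refine (𝓜.exists_unique_circle _ _ _ (𝓜.cls₁_meet_ne L h1) (𝓜.cls₁_meet_ne L h2)
      (𝓜.cls₁_meet_ne L h3) (𝓜.cls₂_meet_ne L (ne h1)) (𝓜.cls₂_meet_ne L (ne h2))
      (𝓜.cls₂_meet_ne L (ne h3))).unique ⟨C.2, ?_, ?_, ?_⟩ ⟨D.2, ?_, ?_, ?_⟩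
    · exact (𝓜.meet_mem_iff_circlePerm L).2 rfl
    · exact (𝓜.meet_mem_iff_circlePerm L).2 rfl
    · exact (𝓜.meet_mem_iff_circlePerm L).2 rfl
    · exact (𝓜.meet_mem_iff_circlePerm L).2 e1.symm
    · exact (𝓜.meet_mem_iff_circlePerm L).2 e2.symm
    · exact (𝓜.meet_mem_iff_circlePerm L).2 e3.symm
  swap := by
    rintro _ _ ⟨C, rfl⟩ ⟨K, rfl⟩ x y hxy e1 e2
    have hC : 𝓜.meet x (𝓜.circlePerm L C x : L.1) ∈ C.1 := (𝓜.meet_mem_iff_circlePerm L).2 rfl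
    refine (hS K C _ ⟨hC, fun hK => hxy ?_⟩ ?_).circlePerm_mul L
    · rw [meet_mem_iff_circlePerm, e1] at hK
      exact (𝓜.circlePerm L K).injective hK
    · rw [symm_meet, meet_mem_iff_circlePerm, e1, Perm.inv_eq_iff_eq.2 rfl, e2]

end HyperbolaStructure

theorem corollary4p4 {P : Type*} (𝓜 : SymmetricMinkowskiPlane P)
    (K L M N : 𝓜.Circle)
    (hi' : ∃ x ∈ M.1, 𝓜.proj₁ x N ≠ 𝓜.proj₁ x L ∧
      𝓜.proj₂ K (𝓜.proj₁ x N) = 𝓜.proj₁ (𝓜.proj₂ L x) K)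
    (hKL : 𝓜.Orthogonal K L) (hKN : 𝓜.Orthogonal K N)
    (hML : 𝓜.Orthogonal M L) (hMN : 𝓜.Orthogonal M N) :
    ∀ k ∈ K.1, ∀ l ∈ L.1, ∀ m ∈ M.1, ∀ n ∈ N.1,
      k ∈ 𝓜.cls₁ l → l ∈ 𝓜.cls₂ m → m ∈ 𝓜.cls₁ n → k ∈ 𝓜.cls₂ n := by
  have hΓ := 𝓜.isSymmetricSharp L 𝓜.2
  have h1 := 𝓜.circlePerm_self L
  have inj := 𝓜.circlePerm_injective L
  have involutive : ∀ {C : 𝓜.Circle}, 𝓜.Orthogonal C L →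
      ∀ t, 𝓜.circlePerm L C (𝓜.circlePerm L C t) = t := by
    intro C h t
    have e := h.circlePerm_mul L
    rw [h1, one_mul, mul_one] at e
    rw [← Perm.eq_inv_iff_eq, e]
  have ne_one : ∀ {C : 𝓜.Circle}, 𝓜.Orthogonal C L → 𝓜.circlePerm L C ≠ 1 :=
    fun h e => h.1 (inj (e.trans h1.symm))
  have ortho : ∀ {C : 𝓜.Circle}, 𝓜.Orthogonal C L → 𝓜.Orthogonal C N → ∀ t,
      𝓜.circlePerm L N (𝓜.circlePerm L C (𝓜.circlePerm L N t)) = 𝓜.circlePerm L C t := by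
    intro C hL hN
    have e := hL.circlePerm_mul L
    rw [h1, one_mul, mul_one] at e
    have e' := hN.circlePerm_mul L
    rw [e] at e'
    exact fun t => DFunLike.congr_fun e' t
  have snd_of_mem : ∀ {C : 𝓜.Circle} {p : P}, p ∈ C.1 →
      𝓜.circlePerm L C (𝓜.fstCoord L p) = 𝓜.sndCoord L p := (𝓜.mem_iff_circlePerm L).1
  have fst_congr : ∀ {p q : P}, 𝓜.cls₁ p = 𝓜.cls₁ q → 𝓜.fstCoord L p = 𝓜.fstCoord L q :=
    fun h => (𝓜.fstCoord_eq_iff L).2 (by rw [h, 𝓜.cls₁_fstCoord])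
  have snd_congr : ∀ {p q : P}, 𝓜.cls₂ p = 𝓜.cls₂ q → 𝓜.sndCoord L p = 𝓜.sndCoord L q :=
    fun h => (𝓜.sndCoord_eq_iff L).2 (by rw [h, 𝓜.cls₂_sndCoord])
  obtain ⟨x, hx, hne, heq⟩ := hi'
  -- a point of `L` has equal coordinates
  have diag : ∀ {p : P}, p ∈ L.1 → 𝓜.fstCoord L p = 𝓜.sndCoord L p := by
    intro p hp
    simpa [h1] using snd_of_mem hp
  have hN : 𝓜.circlePerm L N (𝓜.fstCoord L x) = 𝓜.sndCoord L (𝓜.proj₁ x N) := by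
    rw [← snd_of_mem (𝓜.proj₁_mem x N).2, fst_congr (𝓜.cls₁_proj₁ x N)]
  have hc : 𝓜.circlePerm L N (𝓜.fstCoord L x) =
      𝓜.circlePerm L K (𝓜.circlePerm L M (𝓜.fstCoord L x)) := by
    rw [hN, snd_of_mem hx, ← snd_congr (𝓜.cls₂_proj₂ (𝓜.proj₁ x N) K), heq,
      ← snd_of_mem (𝓜.proj₁_mem _ K).2, fst_congr (𝓜.cls₁_proj₁ _ K),
      diag (𝓜.proj₂_mem L x).2, snd_congr (𝓜.cls₂_proj₂ x L)]
  have hcN : 𝓜.circlePerm L N (𝓜.fstCoord L x) ≠ 𝓜.fstCoord L x := by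
    intro h
    apply hne
    have hL : 𝓜.proj₁ x N ∈ L.1 := by
      rw [𝓜.mem_iff_circlePerm L, h1, Perm.one_apply, ← hN, h, fst_congr (𝓜.cls₁_proj₁ x N)]
    exact 𝓜.eq_of_cls₁_eq hL (𝓜.proj₁_mem x L).2 (by rw [𝓜.cls₁_proj₁, 𝓜.cls₁_proj₁])
  obtain ⟨a, b, c, hab, hbc, hca⟩ := 𝓜.exists_three_mem L
  have key := hΓ.eq_mul_of_apply_eq hab hbc hca ⟨K, rfl⟩ ⟨M, rfl⟩ ⟨N, rfl⟩ (involutive hKL)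
    (involutive hML) (ne_one hKL) (ne_one hML) (inj.ne hKN.1) (inj.ne hMN.1) (ortho hKL hKN)
    (ortho hML hMN) hc hcN
  intro k hk l hl m hm n hn hkl hlm hmn
  have e : 𝓜.sndCoord L k = 𝓜.sndCoord L n := by
    rw [← snd_of_mem hk, ← snd_of_mem hn, key, ← fst_congr (𝓜.cls₁_eq_of_mem hmn),
      Perm.mul_apply, snd_of_mem hm, ← snd_congr (𝓜.cls₂_eq_of_mem hlm), ← diag hl,
      fst_congr (𝓜.cls₁_eq_of_mem hkl)]
  rw [𝓜.mem_cls₂_iff, ← 𝓜.cls₂_sndCoord L k, e, 𝓜.cls₂_sndCoord]
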